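/- Let $R$ be a commutative ring with $1$, let $n\ge 1$, and let $\Omega=R[x_1,\dots,x_n]$; $\deg$ denotes total degree. For $r\in\mathbb N=\{0,1,2,\dots\}$, an $r$-hyperplane of $R^n$ is a set of the form $\{u\in R^n : h(u)=0\}$ with $h\in\Omega$ nonzero and $\deg h=r$. A set $X\subseteq R$ satisfies Condition (D) if for all distinct $a,b\in X$ the difference $b-a$ is not a zero divisor, i.e. there is no $w\ne0$ in $R$ with $(b-a)w=0$. For each $k\in\{1,\dots,n\}$ let $S_k\subseteq R$ be a finite set satisfying Condition (D), let $\psi_k$ assign a positive integer $\psi_k(u)$ to every $u\in S_k$, and let $E_k\subseteq S_k$. Let $L$ be a finite set, let $(e_\lambda)_{\lambda\in L}$ be nonnegative integers, let $H_\lambda$ be an $e_\lambda$-hyperplane of $R^n$ for each $\lambda\in L$, and let $\rho_\lambda\in\Omega$ satisfy $\deg\rho_\lambda=e_\lambda$ and $H_\lambda=\{u\in R^n:\rho_\lambda(u)=0\}$. Let $t\ge1$ be an integer. Assume: (i) for every $a\in\left(\prod_{i=1}^n S_i\right)\setminus\left(\prod_{i=1}^n E_i\right)$, $$|\{\lambda\in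 L : a\in H_\lambda\}|\ \ge\ \max\Big\{\sum_{i=1}^n\beta_i \ :\ \beta\in\mathbb N^n,\ \sum_{i=1}^n\Big\lfloor\frac{\beta_i}{\psi_i(a_i)}\Big\rfloor\le t-1\Big\}+1;$$ (ii) there exists $w\in\prod_{i=1}^n S_i$ with $\prod_{\lambda\in L}\rho_\lambda(w)\neq0$. Then for every $m\in\{1,\dots,n\}$, $$\sum_{\lambda\in L}e_\lambda\ \ge\ \deg\Big(\prod_{\lambda\in L}\rho_\lambda\Big)\ \ge\ (t-1)\sum_{u\in S_m\setminus E_m}\psi_m(u)+\sum_{k=1}^n\ \sum_{u\in S_k\setminus E_k}\psi_k(u).$$ -/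

import Mathlib

open MvPolynomial

/-- Condition (D): for distinct `a, b ∈ X`, the difference `b - a` is not a zero divisor of `R`,
where `u` is a zero divisor if `u * w = 0` for some `w ≠ 0`. -/
def ConditionD {R : Type*} [CommRing R] (X : Set R) : Prop :=
  ∀ a ∈ X, ∀ b ∈ X, a ≠ b → ¬ ∃ w : R, w ≠ 0 ∧ (b - a) * w = 0

/-- `H ⊆ R ^ n` is an `r`-hyperplane: the zero locus of a polynomial of (total) degree `r`.
Having a degree in `ℕ` means in particular that the polynomial is nonzero. -/
def IsRHyperplane {R : Type*} [CommRing R] {n : ℕ} (H : Set (Fin n → R)) (r : ℕ) : Prop :=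
  ∃ h : MvPolynomial (Fin n) R, h ≠ 0 ∧ h.totalDegree = r ∧ H = {u | eval u h = 0}

/-- The set of all `∑ i, β i` with `β ∈ ℕ ^ n` and `∑ i, ⌊β i / p i⌋ ≤ t - 1`
(division in `ℕ` is the floor of the quotient). -/
def weightSet {n : ℕ} (p : Fin n → ℕ) (t : ℕ) : Set ℕ :=
  {s | ∃ β : Fin n → ℕ, ∑ i, β i / p i ≤ t - 1 ∧ s = ∑ i, β i}

/-- `max {∑ i, β i ∣ β ∈ ℕ ^ n, ∑ i, ⌊β i / p i⌋ ≤ t - 1}`. -/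
noncomputable def maxWeight {n : ℕ} (p : Fin n → ℕ) (t : ℕ) : ℕ :=
  sSup (weightSet p t)

/-- For positive `p i` and `t` the maximum is attained, so `maxWeight` is a genuine maximum. -/
theorem isGreatest_maxWeight {n : ℕ} (p : Fin n → ℕ) (hp : ∀ i, 0 < p i) (t : ℕ)
    (ht : 1 ≤ t) : IsGreatest (weightSet p t) (maxWeight p t) := by
  have hne : (weightSet p t).Nonempty := ⟨0, 0, by simp, by simp⟩
  have hbd : BddAbove (weightSet p t) := by
    refine ⟨∑ i, p i * t, ?_⟩
    rintro s ⟨β, hβ, rfl⟩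
    refine Finset.sum_le_sum fun i _ => ?_
    have h1 : β i / p i ≤ ∑ j, β j / p j :=
      Finset.single_le_sum (f := fun j => β j / p j) (fun _ _ => Nat.zero_le _)
        (Finset.mem_univ i)
    have h2 : β i / p i < t := by omega
    exact ((Nat.div_lt_iff_lt_mul (hp i)).1 h2).le.trans (Nat.mul_comm _ _).le
  exact ⟨Nat.sSup_mem hne hbd, fun s hs => le_csSup hbd hs⟩

/-! Over the total ring of fractions `K`, Condition (D) makes differences of grid points units. The
point `w` must lie in `∏ E k`, so restrict to the grid with sides `{w k} ∪ (S k \ E k)`. Give `w k`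
multiplicity 1 and every other `u` multiplicity `ψ k u`, or `t * ψ m u` if `k = m`. At each grid
point other than `w`, so many factors vanish that, by pigeonhole, their product lies in the ideal of
the powers `(X k - a k) ^ c k` (`prod_mem_boxIdeal`). It remains to bound below the degree of a
polynomial with these multiplicities that is nonzero at `w` (`sum_le_totalDegree_of_mem_boxIdeal`).
This goes by induction on `n`: a divided difference in the first variable lowers the degree by the
multiplicities used and leaves a polynomial of the same kind in the other variables. -/

namespace MvPolynomial

/-- The ideal generated by the powers `(X k - y k) ^ c k`. -/
noncomputable def boxIdeal {K σ : Type*} [CommRing K] (y : σ → K) (c : σ → ℕ) : Ideal (MvPolynomial σ K) :=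
  Ideal.span (Set.range fun k => (X k - C (y k)) ^ c k)

theorem sub_C_eval_mem_boxIdeal_one {K σ : Type*} [CommRing K] (y : σ → K)
    (p : MvPolynomial σ K) : p - C (eval y p) ∈ boxIdeal y (fun _ => 1) := by
  set I := boxIdeal y (fun _ => 1) with hI
  have hX : ∀ k, Ideal.Quotient.mk I (X k) = Ideal.Quotient.mk I (C (y k)) := fun k =>
    Ideal.Quotient.eq.2 (Ideal.subset_span ⟨k, by simp⟩)
  have h : Ideal.Quotient.mk I =
      ((Ideal.Quotient.mk I).comp C).comp (eval y) := by
    apply MvPolynomial.ringHom_ext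
    · intro r; simp
    · intro k; simp [hX k]
  exact Ideal.Quotient.eq.1 (by simpa using congrArg (fun f => f p) h)

end MvPolynomial

/-- Each term of the binomial expansion has exponent at least `p + 1` on `I` or at least `q + 1` on
`J`. -/
theorem Ideal.sup_pow_add_add_one_le {A : Type*} [CommRing A] (I J : Ideal A) (p q : ℕ) :
    (I ⊔ J) ^ (p + q + 1) ≤ I ^ (p + 1) ⊔ J ^ (q + 1) := by
  rw [← Ideal.add_eq_sup, ← Ideal.add_eq_sup, add_pow, Ideal.sum_eq_sup]
  refine Finset.sup_le fun i _ => ?_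
  by_cases hi : p + 1 ≤ i
  · exact Ideal.mul_le_left.trans (Ideal.mul_le_left.trans
      ((Ideal.pow_le_pow_right hi).trans le_sup_left))
  · exact Ideal.mul_le_left.trans (Ideal.mul_le_right.trans
      ((Ideal.pow_le_pow_right (by omega)).trans le_sup_right))

/-- Pigeonhole for powers of a finitely generated ideal. -/
theorem Ideal.span_image_pow_le {A ι : Type*} [CommRing A] (f : ι → A) (c : ι → ℕ)
    (s : Finset ι) :
    Ideal.span (f '' s) ^ (∑ k ∈ s, (c k - 1) + 1) ≤ Ideal.span ((fun k => f k ^ c k) '' s) := by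
  classical
  induction s using Finset.induction_on with
  | empty => simp
  | insert a s ha ih =>
    rw [Finset.sum_insert ha, Finset.coe_insert, Set.image_insert_eq, Set.image_insert_eq,
      Ideal.span_insert, Ideal.span_insert]
    rcases Nat.eq_zero_or_pos (c a) with h | h
    -- Exponent zero makes the right-hand ideal the whole ring, so the truncated `c a - 1` does no
    -- harm.
    · simp [h]
    · refine le_trans ?_ (sup_le_sup_left ih _)
      rw [← Ideal.span_singleton_pow]
      obtain ⟨d, hd⟩ : ∃ d, c a = d + 1 := ⟨c a - 1, by omega⟩
      rw [hd]
      exact Ideal.sup_pow_add_add_one_le _ _ _ _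

/-! ### Division by node polynomials in one variable -/

namespace Polynomial

variable {K B : Type*} [CommRing K] [CommRing B] [Algebra K B]

/-- Remainders are linear in the dividend and `G` has scalar coefficients, so a divided difference
is a `K`-combination of the coefficients of `p`. -/
theorem coeff_modByMonic_map_eq_sum {G : K[X]} (hG : G.Monic) (p : B[X]) (D : ℕ) :
    (p %ₘ G.map (algebraMap K B)).coeff D =
      ∑ j ∈ Finset.range (p.natDegree + 1), p.coeff j * algebraMap K B ((X ^ j %ₘ G).coeff D) := by
  have h1 : p = ∑ j ∈ Finset.range (p.natDegree + 1), p.coeff j • (X ^ j : B[X]) := by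
    conv_lhs => rw [p.as_sum_range_C_mul_X_pow]
    simp [smul_eq_C_mul]
  have h2 : ∀ j : ℕ, (X ^ j : B[X]) %ₘ G.map (algebraMap K B) =
      (X ^ j %ₘ G).map (algebraMap K B) := fun j => by
    rw [map_modByMonic _ hG, Polynomial.map_pow, map_X]
  conv_lhs => rw [h1, ← modByMonicHom_apply, map_sum]
  simp [finsetSum_coeff, modByMonicHom_apply, h2, coeff_map]

theorem coeff_X_pow_modByMonic_eq_zero {G : K[X]} (hG : G.Monic) {D j : ℕ} (hj : j < D)
    (hD : D < G.natDegree) : (X ^ j %ₘ G).coeff D = 0 := by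
  nontriviality K
  rw [(modByMonic_eq_self_iff hG).2, coeff_X_pow, if_neg hj.ne']
  rw [degree_X_pow, degree_eq_natDegree hG.ne_zero]
  exact_mod_cast hj.trans hD

variable {ι : Type*}

/-- The monic polynomial with roots `x u`, `u ∈ s`, of multiplicities `c u`. -/
noncomputable def nodePoly (x : ι → K) (c : ι → ℕ) (s : Finset ι) : K[X] :=
  ∏ u ∈ s, (X - C (x u)) ^ c u

theorem monic_nodePoly (x : ι → K) (c : ι → ℕ) (s : Finset ι) : (nodePoly x c s).Monic :=
  monic_prod_of_monic _ _ fun u _ => (monic_X_sub_C (x u)).pow (c u)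

theorem natDegree_nodePoly [Nontrivial K] (x : ι → K) (c : ι → ℕ) (s : Finset ι) :
    (nodePoly x c s).natDegree = ∑ u ∈ s, c u := by
  rw [nodePoly, natDegree_prod_of_monic _ _ fun u _ => (monic_X_sub_C (x u)).pow (c u)]
  refine Finset.sum_congr rfl fun u _ => ?_
  rw [(monic_X_sub_C (x u)).natDegree_pow, natDegree_X_sub_C, mul_one]

/-- Unit differences make the factors pairwise coprime over any `K`-algebra, in particular over
quotients that are not domains. -/
theorem map_nodePoly_dvd {x : ι → K} {c : ι → ℕ} {s : Finset ι}
    (hx : ∀ u ∈ s, ∀ v ∈ s, u ≠ v → IsUnit (x u - x v)) {p : B[X]}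
    (h : ∀ u ∈ s, (X - C (algebraMap K B (x u))) ^ c u ∣ p) :
    (nodePoly x c s).map (algebraMap K B) ∣ p := by
  rw [nodePoly, Polynomial.map_prod]
  simp only [Polynomial.map_pow, Polynomial.map_sub, map_X, map_C]
  refine Finset.prod_dvd_of_coprime (fun u hu v hv huv => ?_) h
  refine IsCoprime.pow (isCoprime_X_sub_C_of_isUnit_sub ?_)
  rw [← map_sub]
  exact (hx u hu v hv huv).map _

/-- The divided difference at nodes `s` (with multiplicities `c`) and one further simple node `w`
of a polynomial vanishing at the nodes `s` only. -/
theorem coeff_modByMonic_nodePoly_ne_zero [DecidableEq ι] {x : ι → K} {c : ι → ℕ} {s : Finset ι} {w : ι}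
    (hw : w ∈ s) (hcw : c w = 1)
    (hx : ∀ u ∈ s, ∀ v ∈ s, u ≠ v → IsUnit (x u - x v)) {p : K[X]}
    (h : ∀ u ∈ s.erase w, (X - C (x u)) ^ c u ∣ p) (hp : p.eval (x w) ≠ 0) :
    (p %ₘ nodePoly x c s).coeff (∑ u ∈ s.erase w, c u) ≠ 0 := by
  nontriviality K
  obtain ⟨q, rfl⟩ : nodePoly x c (s.erase w) ∣ p := by
    have := map_nodePoly_dvd (B := K) (x := x) (c := c) (s := s.erase w) (p := p)
      (fun u hu v hv => hx u (Finset.mem_of_mem_erase hu) v (Finset.mem_of_mem_erase hv))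
      (by simpa using h)
    simpa using this
  set N := nodePoly x c (s.erase w) with hN
  have hNm : N.Monic := monic_nodePoly ..
  have hNd : N.natDegree = ∑ u ∈ s.erase w, c u := natDegree_nodePoly ..
  have hs : nodePoly x c s = (X - C (x w)) * N := by
    rw [nodePoly, ← Finset.mul_prod_erase s _ hw, hcw, pow_one]; rfl
  have hsm : (nodePoly x c s).Monic := monic_nodePoly ..
  -- Modulo `X - x w`, `q` is the constant `q(x w)`; multiply by `N`.
  have hmod : (N * q) %ₘ nodePoly x c s = C (q.eval (x w)) * N := by
    refine (div_modByMonic_unique (q /ₘ (X - C (x w))) _ hsm ⟨?_, ?_⟩).2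
    · have := modByMonic_add_div q (X - C (x w))
      rw [modByMonic_X_sub_C_eq_C_eval] at this
      conv_rhs => rw [← this]
      rw [hs]; ring
    · rw [hs, hNm.degree_mul (p := X - C (x w)), degree_X_sub_C]
      rw [C_mul']
      refine (degree_smul_le _ _).trans_lt ?_
      rw [degree_eq_natDegree hNm.ne_zero]
      exact_mod_cast (by omega : N.natDegree < 1 + N.natDegree)
  rw [hmod, coeff_C_mul, ← hNd, hNm.coeff_natDegree, mul_one]
  intro h0
  exact hp (by rw [eval_mul, h0, mul_zero])

end Polynomial

/-! ### Punctured Nullstellensatz with multiplicities -/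

namespace MvPolynomial

theorem totalDegree_map_le' {R K σ : Type*} [CommRing R] [CommRing K] (f : R →+* K)
    (p : MvPolynomial σ R) : (map f p).totalDegree ≤ p.totalDegree :=
  Finset.sup_mono (support_map_subset f p)

variable {K : Type*} [CommRing K] {n : ℕ}

/-- Taking a divided difference with `D + 1` nodes in one variable lowers the degree by `D`. -/
theorem totalDegree_coeff_modByMonic_add_le {G : Polynomial K} (hG : G.Monic) {D : ℕ}
    (hD : D < G.natDegree) (P : MvPolynomial (Fin (n + 1)) K)
    (hQ : (finSuccEquiv K n P %ₘ G.map (algebraMap K (MvPolynomial (Fin n) K))).coeff D ≠ 0) :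
    ((finSuccEquiv K n P %ₘ G.map (algebraMap K (MvPolynomial (Fin n) K))).coeff D).totalDegree +
      D ≤ P.totalDegree := by
  set Q := (finSuccEquiv K n P %ₘ G.map (algebraMap K (MvPolynomial (Fin n) K))).coeff D with hQd
  obtain ⟨s, hs, hsd⟩ := Finset.exists_mem_eq_sup Q.support (support_nonempty.2 hQ)
    (fun s => s.sum fun _ e => e)
  change Q.totalDegree = _ at hsd
  rw [mem_support_iff, hQd, Polynomial.coeff_modByMonic_map_eq_sum hG, coeff_sum] at hs
  obtain ⟨j, -, hj⟩ := Finset.exists_ne_zero_of_sum_ne_zero hs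
  rw [algebraMap_eq, mul_comm, coeff_C_mul] at hj
  have hjD : D ≤ j := by
    by_contra! hlt
    exact hj (by rw [Polynomial.coeff_X_pow_modByMonic_eq_zero hG hlt hD, zero_mul])
  have hjs : s ∈ ((finSuccEquiv K n P).coeff j).support := by
    rw [mem_support_iff]
    exact right_ne_zero_of_mul hj
  have h1 := le_totalDegree hjs
  have h2 := totalDegree_coeff_finSuccEquiv_add_le P j
    (by rintro h0; simp [h0] at hjs)
  omega

/-- Since `f` kills the generators in the later variables, only the generator in the first one
survives. -/
theorem X_sub_C_pow_dvd_map_finSuccEquiv {B : Type*} [CommRing B] [Algebra K B]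
    (f : MvPolynomial (Fin n) K →ₐ[K] B) {y₀ : K} {y : Fin n → K} {c₀ : ℕ} {c : Fin n → ℕ}
    (hf : ∀ k, f ((X k - C (y k)) ^ c k) = 0)
    {P : MvPolynomial (Fin (n + 1)) K} (hP : P ∈ boxIdeal (Fin.cons y₀ y) (Fin.cons c₀ c)) :
    (Polynomial.X - Polynomial.C (algebraMap K B y₀)) ^ c₀ ∣
      (finSuccEquiv K n P).map (f : MvPolynomial (Fin n) K →+* B) := by
  rw [← Ideal.mem_span_singleton]
  suffices boxIdeal (Fin.cons y₀ y) (Fin.cons c₀ c) ≤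
      (Ideal.span {(Polynomial.X - Polynomial.C (algebraMap K B y₀)) ^ c₀}).comap
      ((Polynomial.mapRingHom (f : MvPolynomial (Fin n) K →+* B)).comp
        (finSuccEquiv K n : _ →+* Polynomial (MvPolynomial (Fin n) K))) from this hP
  have hC : ∀ r : K, finSuccEquiv K n (C r) = Polynomial.C (C r) := fun r =>
    ((finSuccEquiv K n).commutes r).trans rfl
  rw [boxIdeal, Ideal.span_le]
  rintro _ ⟨k, rfl⟩
  refine Fin.cases ?_ (fun k => ?_) k
  · refine Ideal.mem_span_singleton.2 (dvd_of_eq ?_)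
    have : f (C y₀) = algebraMap K B y₀ := f.commutes _
    simp [hC, finSuccEquiv_X_zero, this]
  · have : ((Polynomial.mapRingHom (f : MvPolynomial (Fin n) K →+* B)).comp
        (finSuccEquiv K n : _ →+* Polynomial (MvPolynomial (Fin n) K)))
          ((X k.succ - C (y k)) ^ c k) =
        Polynomial.C (f ((X k - C (y k)) ^ c k)) := by
      simp [hC, finSuccEquiv_X_succ]
    simp only [SetLike.mem_coe, Ideal.mem_comap, Fin.cons_succ]
    rw [this, hf, Polynomial.C_0]
    exact Submodule.zero_mem _

/-- The punctured Nullstellensatz with box-shaped multiplicities: a polynomial vanishing to order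
`c` at every point of a grid except `w`, where it does not vanish, has large degree. -/
theorem sum_le_totalDegree_of_mem_boxIdeal {ι : Type*} [DecidableEq ι] (x : ι → K) :
    ∀ {n : ℕ} (U : Fin n → Finset ι) (c : Fin n → ι → ℕ) (w : Fin n → ι)
      (_ : ∀ k, w k ∈ U k) (_ : ∀ k, c k (w k) = 1)
      (_ : ∀ k, ∀ u ∈ U k, ∀ v ∈ U k, u ≠ v → IsUnit (x u - x v))
      (P : MvPolynomial (Fin n) K)
      (_ : ∀ a : Fin n → ι, (∀ k, a k ∈ U k) → a ≠ w →
        P ∈ boxIdeal (fun k => x (a k)) fun k => c k (a k))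
      (_ : eval (fun k => x (w k)) P ≠ 0),
      ∑ k, ∑ u ∈ (U k).erase (w k), c k u ≤ P.totalDegree := by
  intro n
  induction n with
  | zero => intros; simp
  | succ n ih =>
    intro U c w hw hcw hx P hP hPw
    have : Nontrivial K := nontrivial_of_ne _ _ hPw
    set G := Polynomial.nodePoly x (c 0) (U 0) with hGd
    set D := ∑ u ∈ (U 0).erase (w 0), c 0 u with hDd
    have hG : G.Monic := Polynomial.monic_nodePoly ..
    have hGD : D < G.natDegree := by
      rw [hGd, Polynomial.natDegree_nodePoly, ← Finset.add_sum_erase _ _ (hw 0), hcw]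
      omega
    set Q := (finSuccEquiv K n P %ₘ G.map (algebraMap K (MvPolynomial (Fin n) K))).coeff D with hQd
    -- Monic division commutes with base change: `f` may be applied before dividing.
    have hfQ : ∀ {B : Type _} [CommRing B] [Algebra K B] (f : MvPolynomial (Fin n) K →ₐ[K] B),
        f Q = ((finSuccEquiv K n P).map (f : MvPolynomial (Fin n) K →+* B) %ₘ
          G.map (algebraMap K B)).coeff D := by
      intro B _ _ f
      have : algebraMap K B = (f : MvPolynomial (Fin n) K →+* B).comp (algebraMap K _) := by
        ext r; simp
      rw [this, ← Polynomial.map_map, ← Polynomial.map_modByMonic _ (hG.map _),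
        Polynomial.coeff_map]
      rfl
    have hPcons : ∀ u ∈ U 0, ∀ a : Fin n → ι, (∀ k, a k ∈ U k.succ) →
        (u ≠ w 0 ∨ a ≠ fun k => w k.succ) →
        P ∈ boxIdeal (Fin.cons (x u) fun k => x (a k))
          (Fin.cons (c 0 u) fun k => c k.succ (a k)) := by
      intro u hu a ha hne
      have h1 := hP (Fin.cons u a) (Fin.forall_fin_succ.2 ⟨hu, ha⟩) (by
        rintro rfl
        simp at hne)
      convert h1 using 1
      congr 1
      · exact _root_.funext (Fin.forall_fin_succ.2 ⟨rfl, fun _ => rfl⟩)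
      · exact _root_.funext (Fin.forall_fin_succ.2 ⟨rfl, fun _ => rfl⟩)
    have hQw : eval (fun k : Fin n => x (w k.succ)) Q ≠ 0 := by
      have h1 := hfQ (aeval fun k : Fin n => x (w k.succ))
      have h2 : ((aeval fun k : Fin n => x (w k.succ) : MvPolynomial (Fin n) K →ₐ[K] K) :
          MvPolynomial (Fin n) K →+* K) = eval fun k : Fin n => x (w k.succ) := by
        ext <;> simp
      have h3 : ∀ q, aeval (fun k : Fin n => x (w k.succ)) q =
          eval (fun k : Fin n => x (w k.succ)) q := fun q => congr($h2 q)
      rw [h3] at h1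
      rw [h1, Algebra.algebraMap_self, Polynomial.map_id]
      refine Polynomial.coeff_modByMonic_nodePoly_ne_zero (hw 0) (hcw 0) (hx 0) ?_ ?_
      · intro u hu
        have hdvd := X_sub_C_pow_dvd_map_finSuccEquiv (aeval fun k : Fin n => x (w k.succ))
          (fun k => by simp [hcw])
          (hPcons u (Finset.mem_of_mem_erase hu) _ (fun k => hw k.succ)
            (Or.inl (Finset.ne_of_mem_erase hu)))
        rwa [Algebra.algebraMap_self, RingHom.id_apply] at hdvd
      · rw [h2, ← eval_eq_eval_mv_eval']
        have hcons : (Fin.cons (x (w 0)) fun k => x (w k.succ) : Fin (n + 1) → K) =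
            fun k => x (w k) := _root_.funext (Fin.forall_fin_succ.2 ⟨rfl, fun _ => rfl⟩)
        rwa [hcons]
    have hQ0 : Q ≠ 0 := by
      rintro h0
      simp [h0] at hQw
    have hdeg : Q.totalDegree + D ≤ P.totalDegree :=
      totalDegree_coeff_modByMonic_add_le hG hGD P hQ0
    have hrec := ih (fun k => U k.succ) (fun k => c k.succ) (fun k => w k.succ)
      (fun k => hw _) (fun k => hcw _) (fun k => hx _) Q ?_ hQw
    · rw [Fin.sum_univ_succ]
      omega
    · intro a ha hne
      set J := boxIdeal (fun k => x (a k)) fun k => c k.succ (a k) with hJ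
      have h1 := hfQ (Ideal.Quotient.mkₐ K J)
      rw [← Ideal.Quotient.eq_zero_iff_mem]
      refine h1.trans ?_
      -- As `a` differs from the tail of `w`, every node of `U 0`, even `w 0`, contributes its full
      -- power, so `G` divides and the remainder is zero.
      rw [(Polynomial.modByMonic_eq_zero_iff_dvd (hG.map _)).2, Polynomial.coeff_zero]
      refine Polynomial.map_nodePoly_dvd (hx 0) fun u hu => ?_
      refine X_sub_C_pow_dvd_map_finSuccEquiv _ (fun k => ?_) (hPcons u hu a ha (Or.inr hne))
      exact Ideal.Quotient.eq_zero_iff_mem.2 (Ideal.subset_span ⟨k, rfl⟩)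

/-! ### From the covering hypothesis to multiplicities -/

theorem _root_.isUnit_algebraMap_sub_of_conditionD {R : Type*} [CommRing R] {X : Set R}
    (hX : ConditionD X) {a b : R} (ha : a ∈ X) (hb : b ∈ X) (hab : a ≠ b) :
    IsUnit (algebraMap R (FractionRing R) a - algebraMap R (FractionRing R) b) := by
  rw [← map_sub]
  refine IsLocalization.map_units (FractionRing R)
    (⟨a - b, mem_nonZeroDivisors_iff_left.2 fun w hw => ?_⟩ : nonZeroDivisors R)
  by_contra h0
  exact hX b hb a ha hab.symm ⟨w, h0, hw⟩

/-- A product of polynomials, more than `∑ k, (c k - 1)` of which vanish at `y`, vanishes at `y`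
to order `c`. -/
theorem prod_mem_boxIdeal {K σ L : Type*} [CommRing K] [Fintype σ] [Fintype L]
    (ρ : L → MvPolynomial σ K) (y : σ → K) (c : σ → ℕ)
    (h : ∑ k, (c k - 1) + 1 ≤ Set.ncard {l | eval y (ρ l) = 0}) :
    ∏ l, ρ l ∈ boxIdeal y c := by
  classical
  have hcard : Set.ncard {l | eval y (ρ l) = 0} =
      (Finset.univ.filter fun l => eval y (ρ l) = 0).card := by
    rw [← Set.ncard_coe_finset]; simp
  rw [← Finset.prod_filter_mul_prod_filter_not Finset.univ fun l => eval y (ρ l) = 0]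
  refine Ideal.mul_mem_right _ _ ?_
  have h1 : ∏ l with eval y (ρ l) = 0, ρ l ∈
      boxIdeal y (fun _ => 1) ^ (Finset.univ.filter fun l => eval y (ρ l) = 0).card := by
    rw [← Finset.prod_const]
    refine Ideal.prod_mem_prod fun l hl => ?_
    have := sub_C_eval_mem_boxIdeal_one y (ρ l)
    rwa [(Finset.mem_filter.1 hl).2, C_0, sub_zero] at this
  have h2 := Ideal.span_image_pow_le (fun k : σ => X k - C (y k)) c Finset.univ
  simp only [Finset.coe_univ, Set.image_univ] at h2
  refine h2 (Ideal.pow_le_pow_right (h.trans hcard.le) ?_)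
  simpa [boxIdeal] using h1

end MvPolynomial

/-- The vector `β = c - 1` is admissible: its floors are 0 off `m` and at most `t - 1` at `m`. -/
theorem sum_sub_one_le_maxWeight {n : ℕ} (p c : Fin n → ℕ) (hp : ∀ i, 0 < p i) {t : ℕ} (ht : 1 ≤ t)
    (m : Fin n) (hc : ∀ i, c i ≤ if i = m then t * p i else p i) :
    ∑ i, (c i - 1) ≤ maxWeight p t := by
  refine (isGreatest_maxWeight p hp t ht).2 ⟨fun i => c i - 1, ?_, rfl⟩
  calc ∑ i, (c i - 1) / p i ≤ ∑ i, if i = m then t - 1 else 0 := by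
        refine Finset.sum_le_sum fun i _ => ?_
        have h1 := hc i
        have h2 := hp i
        split_ifs at h1 ⊢ with him
        · refine Nat.le_sub_one_of_lt ((Nat.div_lt_iff_lt_mul h2).2 ?_)
          have := Nat.mul_pos ht h2
          omega
        · rw [Nat.div_eq_of_lt (by omega)]
    _ = t - 1 := by simp

theorem theorem6p1 {R : Type*} [CommRing R] [DecidableEq R] {n : ℕ}
    -- finite multisets `(S k, ψ k)` in `R`, and `E k ⊆ S k`
    (S E : Fin n → Finset R) (ψ : Fin n → R → ℕ)
    (hψ : ∀ k, ∀ u ∈ S k, 0 < ψ k u)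
    (hE : ∀ k, E k ⊆ S k)
    (hD : ∀ k, ConditionD (S k : Set R))
    {L : Type*} [Fintype L] (e : L → ℕ) (H : L → Set (Fin n → R))
    (hH : ∀ l, IsRHyperplane (H l) (e l))
    (ρ : L → MvPolynomial (Fin n) R)
    (hρdeg : ∀ l, (ρ l).totalDegree = e l)
    (hρ : ∀ l, H l = {u | eval u (ρ l) = 0})
    (t : ℕ) (ht : 1 ≤ t)
    (hcover : ∀ a ∈ (Set.univ.pi fun i => (S i : Set R)) \ (Set.univ.pi fun i => (E i : Set R)),
      maxWeight (fun i => ψ i (a i)) t + 1 ≤ Set.ncard {l | a ∈ H l})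
    (hw : ∃ w ∈ Set.univ.pi fun i => (S i : Set R), eval w (∏ l, ρ l) ≠ 0)
    (m : Fin n) :
    (∏ l, ρ l).totalDegree ≤ ∑ l, e l ∧
      (t - 1) * (∑ u ∈ S m \ E m, ψ m u) + ∑ k, ∑ u ∈ S k \ E k, ψ k u
        ≤ (∏ l, ρ l).totalDegree := by
  classical
  refine ⟨(totalDegree_finsetProd _ _).trans_eq (Finset.sum_congr rfl fun l _ => hρdeg l), ?_⟩
  obtain ⟨w, hwS, hPw⟩ := hw
  have hwS' : ∀ k, w k ∈ S k := fun k => hwS k trivial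
  -- Otherwise the covering condition gives a factor vanishing at `w`.
  have hwE : ∀ k, w k ∈ E k := by
    by_contra! hcon
    obtain ⟨k, hk⟩ := hcon
    have h1 := hcover w ⟨hwS, fun h => hk (h k trivial)⟩
    obtain ⟨l, hl⟩ := Set.nonempty_of_ncard_ne_zero (s := {l | w ∈ H l}) (by omega)
    have hl' : eval w (ρ l) = 0 := by simpa [hρ] using hl
    exact hPw (by rw [map_prod]; exact Finset.prod_eq_zero (Finset.mem_univ l) hl')
  set f := algebraMap R (FractionRing R) with hf
  have hinj : Function.Injective f := IsLocalization.injective _ le_rfl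
  have heval : ∀ (a : Fin n → R) (p : MvPolynomial (Fin n) R),
      eval (fun k => f (a k)) (map f p) = f (eval a p) := fun a p => by
    rw [eval_map]
    exact (eval₂_comp f a p).symm
  -- The extra factor `t` in the single direction `m` yields the term with `t - 1`.
  set c : Fin n → R → ℕ := fun k u =>
    if u = w k then 1 else if k = m then t * ψ k u else ψ k u with hc
  have hmain := sum_le_totalDegree_of_mem_boxIdeal f (fun k => insert (w k) (S k \ E k)) c w
    (fun k => Finset.mem_insert_self _ _) (fun k => by simp [hc]) ?_ (map f (∏ l, ρ l)) ?_ ?_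
  · refine le_trans (le_of_eq ?_) (hmain.trans (totalDegree_map_le' f _))
    have hsum : ∀ k, ∑ u ∈ (insert (w k) (S k \ E k)).erase (w k), c k u =
        (if k = m then (t - 1) * ∑ u ∈ S m \ E m, ψ m u else 0) + ∑ u ∈ S k \ E k, ψ k u := by
      intro k
      have hwk : w k ∉ S k \ E k := by simp [hwE k]
      rw [Finset.erase_insert hwk, Finset.sum_congr rfl (g := fun u =>
        if k = m then t * ψ k u else ψ k u) fun u hu => if_neg (ne_of_mem_of_not_mem hu hwk)]
      obtain ⟨s, rfl⟩ : ∃ s, t = s + 1 := ⟨t - 1, by omega⟩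
      split_ifs with hkm
      · subst hkm
        rw [← Finset.mul_sum]
        simp [add_mul]
      · simp
    rw [Finset.sum_congr rfl fun k _ => hsum k, Finset.sum_add_distrib]
    simp
  · intro k u hu v hv huv
    have hUS : ∀ u ∈ insert (w k) (S k \ E k), u ∈ S k := fun u hu => by
      rcases Finset.mem_insert.1 hu with rfl | hu
      exacts [hwS' k, (Finset.mem_sdiff.1 hu).1]
    exact isUnit_algebraMap_sub_of_conditionD (hD k) (hUS u hu) (hUS v hv) huv
  · intro a ha haw
    have haS : ∀ k, a k ∈ S k := fun k => by
      rcases Finset.mem_insert.1 (ha k) with h | h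
      exacts [h ▸ hwS' k, (Finset.mem_sdiff.1 h).1]
    have haE : ∃ k, a k ∉ E k := by
      obtain ⟨k, hk⟩ := Function.ne_iff.1 haw
      exact ⟨k, (Finset.mem_sdiff.1 ((Finset.mem_insert.1 (ha k)).resolve_left hk)).2⟩
    obtain ⟨k₀, hk₀⟩ := haE
    have h1 := hcover a ⟨fun k _ => haS k, fun h => hk₀ (h k₀ trivial)⟩
    rw [map_prod]
    refine prod_mem_boxIdeal _ _ _ ?_
    have hset : {l | eval (fun k => f (a k)) (map f (ρ l)) = 0} = {l | a ∈ H l} := by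
      ext l
      simp only [Set.mem_ofPred_eq, heval, hρ, map_eq_zero_iff f hinj]
    rw [hset]
    refine le_trans (Nat.succ_le_succ ?_) h1
    refine sum_sub_one_le_maxWeight _ _ (fun i => hψ i _ (haS i)) ht m fun i => ?_
    have h2 := hψ i _ (haS i)
    have h3 := Nat.mul_pos ht h2
    simp only [hc]
    split_ifs <;> omega
  · rw [heval, Ne, map_eq_zero_iff f hinj]
    exact hPw
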